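/- Let $(\Omega,\mathcal F,P)$ be a probability space, let $(\mathcal F_i)_{i\ge 0}$ be a filtration of sub-$\sigma$-algebras of $\mathcal F$, and let $(Y_i)_{i\ge 0}$ be real random variables with $E[Y_i^2]<\infty$ for every $i$. Assume that * $(Y_i)$ is a martingale difference sequence: $Y_i$ is $\mathcal F_i$-measurable and $E[Y_{i+1}\mid\mathcal F_i]=0$ almost surely for every $i\ge 0$; * $(Y_i)$ is stationary: for every $m\ge 0$ the sequence $(Y_{m},Y_{m+1},\dots)$ has the same distribution as $(Y_0,Y_1,\dots)$; * $(Y_i)$ is ergodic: for every measurable set $A\subseteq\mathbb R^{\mathbb N}$ with $\theta^{-1}A=A$, where $\theta(x_0,x_1,\dots)=(x_1,x_2,\dots)$ is the shift, $P\big((Y_0,Y_1,\dots)\in A\big)\in\{0,1\}$. Then $$\frac1{\sqrt n}\sum_{i=0}^{n-1}Y_i\longrightarrow N(0,\sigma^2)\quad\text{in distribution as } n\to\infty,$$ where $\sigma^2=\operatorname{Var}(Y_i)$, which is the same for all $i$ (for $\sigma^2=0$, $N(0,0)$ is the unit mass at $0$). -/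

import Mathlib

open MeasureTheory ProbabilityTheory Filter

/-- The left shift `(x₀, x₁, x₂, …) ↦ (x₁, x₂, x₃, …)` on the space of real sequences. -/
def seqShift (x : ℕ → ℝ) : ℕ → ℝ := fun n => x (n + 1)

/-- The law, on the sequence space `ℕ → ℝ` with its product σ-algebra, of the process `Y`. -/
noncomputable def pathLaw {Ω : Type*} [MeasurableSpace Ω] (Y : ℕ → Ω → ℝ) (P : Measure Ω) :
    Measure (ℕ → ℝ) :=
  P.map (fun ω n => Y n ω)

/-- The sequence `Y` is (strictly) stationary: for every `m`, the shifted sequence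
`(Y m, Y (m + 1), …)` has the same distribution as `(Y 0, Y 1, …)`. -/
def IsStationarySeq {Ω : Type*} [MeasurableSpace Ω] (Y : ℕ → Ω → ℝ) (P : Measure Ω) : Prop :=
  ∀ m : ℕ, IdentDistrib (fun ω n => Y (m + n) ω) (fun ω n => Y n ω) P P

/-- Ergodicity of a sequence `Y` (used for stationary `Y`): every measurable set of
sequences which is invariant under the shift has probability `0` or `1` under the law of `Y`. -/
def IsErgodicSeq {Ω : Type*} [MeasurableSpace Ω] (Y : ℕ → Ω → ℝ) (P : Measure Ω) : Prop :=
  PreErgodic seqShift (pathLaw Y P)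

/-- `Y` is a martingale difference sequence with respect to the filtration `ℱ`: it is adapted,
integrable, and `E[Y (n + 1) | ℱ n] = 0` almost surely for every `n`. -/
structure IsMartingaleDifference {Ω : Type*} {mΩ : MeasurableSpace Ω} (Y : ℕ → Ω → ℝ)
    (ℱ : Filtration ℕ mΩ) (P : Measure Ω) : Prop where
  adapted : StronglyAdapted ℱ Y
  integrable : ∀ n, Integrable (Y n) P
  condExp_eq_zero : ∀ n, P[Y (n + 1) | ℱ n] =ᵐ[P] 0

/-! Pass to the law of the path, where the shift `T` is ergodic and the partial sums are Birkhoff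
sums of the zeroth coordinate `f`. With `l = t/√n`, `v = ∫ f²` and `q = exp(-l²v/2)`, telescope the
characteristic function of the sum against `qⁿ`, which equals `exp(-t²v/2)`. To second order each
increment contributes a term linear in `f ∘ T^k`, killed in the mean by the martingale property, and
a term `-(l²/2)(f² - v) ∘ T^k` with a weight of modulus at most 1.

Ergodicity handles the quadratic term: `f² - v` is `L¹`-close to a coboundary `h - h ∘ T` with `h`
in `L²` (`Ergodic.exists_integral_abs_sub_coboundary_lt`). Summation by parts moves the differences
onto the weights, which vary by `O(l)` per step, so the coboundary costs `O(n l³) + O(l²)`, which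
vanishes. The `L¹` error `δ` costs `n l² δ/2 = t²δ/2`, arbitrarily small. The deterministic estimate
is `norm_cexp_sum_sub_pow_sub_le`. -/

/-! ### Approximation by coboundaries in `L²` and `L¹` -/

section Coboundary

variable {X : Type*} [MeasurableSpace X] {μ : Measure X} {T : X → X}

theorem MeasureTheory.integral_abs_le_norm_toLp_two [IsProbabilityMeasure μ] {w : X → ℝ}
    (hw : MemLp w 2 μ) : ∫ x, |w x| ∂μ ≤ ‖hw.toLp w‖ := by
  have h := eLpNorm_le_eLpNorm_of_exponent_le (μ := μ) (p := 1) (q := 2) (by norm_num) hw.1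
  have h2 : ∫ x, |w x| ∂μ = (eLpNorm w 1 μ).toReal := by
    rw [eLpNorm_one_eq_lintegral_enorm]
    simpa using integral_norm_eq_lintegral_enorm (μ := μ) hw.1
  rw [h2, Lp.norm_toLp]
  exact ENNReal.toReal_mono hw.eLpNorm_ne_top h

/-- Von Neumann's argument: a vector orthogonal to the range of `U - 1`, for the Koopman isometry
`U`, is fixed by `U`, hence constant by ergodicity; a centered function is orthogonal to constants,
so it lies in the closure of that range. -/
theorem Ergodic.exists_integral_abs_sub_coboundary_lt_of_memLp_two [IsProbabilityMeasure μ]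
    (hT : Ergodic T μ) {g : X → ℝ} (hg : MemLp g 2 μ) {ε : ℝ} (hε : 0 < ε) :
    ∃ h : X → ℝ, MemLp h 2 μ ∧
      ∫ x, |g x - ∫ y, g y ∂μ - (h x - h (T x))| ∂μ < ε := by
  have hTm := hT.toMeasurePreserving
  set c := ∫ y, g y ∂μ with hc
  have hgc : MemLp (fun x => g x - c) 2 μ := hg.sub (memLp_const c)
  let U : Lp ℝ 2 μ →L[ℝ] Lp ℝ 2 μ :=
    (Lp.compMeasurePreservingₗᵢ ℝ T hTm).toContinuousLinearMap
  have hUnorm : ∀ x, ‖U x‖ = ‖x‖ := fun x =>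
    (Lp.compMeasurePreservingₗᵢ ℝ T hTm).norm_map x
  have hUfix : ∀ x : Lp ℝ 2 μ, U x = x → ∃ a : ℝ, x =ᵐ[μ] fun _ => a := by
    intro x hx
    refine hT.ae_eq_const_of_ae_eq_comp_ae (Lp.aestronglyMeasurable x) ?_
    refine (Lp.coeFn_compMeasurePreserving x hTm).symm.trans ?_
    change (U x : X → ℝ) =ᵐ[μ] x
    rw [hx]
  let R : Submodule ℝ (Lp ℝ 2 μ) := LinearMap.range ((U - 1 : Lp ℝ 2 μ →L[ℝ] Lp ℝ 2 μ) : Lp ℝ 2 μ →ₗ[ℝ] Lp ℝ 2 μ)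
  have hmem : hgc.toLp _ ∈ R.topologicalClosure := by
    rw [← Submodule.orthogonal_orthogonal_eq_closure, Submodule.mem_orthogonal]
    intro x hx
    -- Orthogonality to `U x - x` gives `⟪U x, x⟫ = ‖x‖²`; since `‖U x‖ = ‖x‖`, this is the equality
    -- case of Cauchy–Schwarz.
    have hfix : U x = x := by
      refine eq_of_norm_le_re_inner_eq_norm_sq (𝕜 := ℝ) (hUnorm x).le ?_
      have h1 := (Submodule.mem_orthogonal _ _).1 hx ((U - 1) x) ⟨x, rfl⟩
      have h2 : inner ℝ (U x) x = inner ℝ x x := by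
        simpa [inner_sub_left, sub_eq_zero] using h1
      simp [h2]
    obtain ⟨a, ha⟩ := hUfix x hfix
    rw [L2.inner_def]
    have : ∫ y, inner ℝ (x y) (hgc.toLp _ y) ∂μ = ∫ y, (g y - c) * a ∂μ := by
      refine integral_congr_ae ?_
      filter_upwards [ha, hgc.coeFn_toLp] with y h1 h2
      simp [h1, h2]
    rw [this, integral_mul_const, integral_sub (hg.integrable (by norm_num)) (by simp)]
    simp [hc]
  obtain ⟨_, ⟨h, rfl⟩, hh⟩ := Metric.mem_closure_iff.1 hmem ε hε
  -- The range of `U - 1` produces `h ∘ T - h`, hence the sign.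
  have hhm : MemLp (fun x => -h x) 2 μ := (Lp.memLp h).neg
  have hw : MemLp (fun x => g x - c - (-h x - -h (T x))) 2 μ :=
    hgc.sub (hhm.sub (hhm.comp_measurePreserving hTm))
  refine ⟨fun x => -h x, hhm, (integral_abs_le_norm_toLp_two hw).trans_lt ?_⟩
  rw [dist_eq_norm] at hh
  suffices hww : hw.toLp _ = hgc.toLp _ - (U - 1) h by rw [hww]; exact hh
  refine Lp.ext ?_
  have h3 := Lp.coeFn_compMeasurePreserving h hTm
  filter_upwards [hw.coeFn_toLp, hgc.coeFn_toLp, h3, Lp.coeFn_sub (hgc.toLp _) (U h - h),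
    Lp.coeFn_sub (U h) h] with x e1 e2 e3 e4 e5
  have e4' : (hgc.toLp _ - (U - 1) h : Lp ℝ 2 μ) x = hgc.toLp _ x - (U h - h : Lp ℝ 2 μ) x := e4
  have e3' : (U h) x = h (T x) := e3
  rw [e1]
  refine Eq.trans ?_ e4'.symm
  rw [e2, e5, Pi.sub_apply, e3']
  ring

/-- Over an ergodic system, every centered integrable function is an `L¹`-limit of coboundaries
of square integrable functions. -/
theorem Ergodic.exists_integral_abs_sub_coboundary_lt [IsProbabilityMeasure μ]
    (hT : Ergodic T μ) {g : X → ℝ} (hg : Integrable g μ) {ε : ℝ} (hε : 0 < ε) :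
    ∃ h : X → ℝ, MemLp h 2 μ ∧
      ∫ x, |g x - ∫ y, g y ∂μ - (h x - h (T x))| ∂μ < ε := by
  have hTm := hT.toMeasurePreserving
  obtain ⟨s, hs, hs1⟩ := (memLp_one_iff_integrable.2 hg).exists_simpleFunc_eLpNorm_sub_lt
    (by norm_num) (ε := ENNReal.ofReal (ε / 3)) (by simpa using hε)
  have hs2 : MemLp s 2 μ := s.memLp_of_isFiniteMeasure 2 μ
  have hsi : Integrable s μ := memLp_one_iff_integrable.1 hs1
  have hgs : ∫ x, |g x - s x| ∂μ < ε / 3 := by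
    have h2 : ∫ x, |g x - s x| ∂μ = (eLpNorm (g - ⇑s) 1 μ).toReal := by
      rw [eLpNorm_one_eq_lintegral_enorm]
      simpa using integral_norm_eq_lintegral_enorm (μ := μ) (hg.sub hsi).1
    rw [h2]
    exact (ENNReal.lt_ofReal_iff_toReal_lt hs.ne_top).1 hs
  obtain ⟨h, hh, hhs⟩ :=
    hT.exists_integral_abs_sub_coboundary_lt_of_memLp_two hs2 (by positivity : 0 < ε / 3)
  refine ⟨h, hh, ?_⟩
  have hhi : Integrable h μ := hh.integrable (by norm_num)
  have hhT : Integrable (fun x => h (T x)) μ := hTm.integrable_comp_of_integrable hhi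
  have hmean : |∫ y, s y ∂μ - ∫ y, g y ∂μ| < ε / 3 := by
    rw [abs_sub_comm, ← integral_sub hg hsi]
    exact (abs_integral_le_integral_abs).trans_lt hgs
  have i1 : Integrable (fun x => |g x - s x|) μ := (hg.sub hsi).abs
  have i2 : Integrable (fun x => |s x - ∫ y, s y ∂μ - (h x - h (T x))|) μ :=
    ((hsi.sub (integrable_const _)).sub (hhi.sub hhT)).abs
  calc ∫ x, |g x - ∫ y, g y ∂μ - (h x - h (T x))| ∂μ
      ≤ ∫ x, (|g x - s x| + |s x - ∫ y, s y ∂μ - (h x - h (T x))|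
          + |∫ y, s y ∂μ - ∫ y, g y ∂μ|) ∂μ := by
        refine integral_mono ((hg.sub (integrable_const _)).sub (hhi.sub hhT)).abs
          ((i1.add i2).add (integrable_const _)) fun x => ?_
        refine le_trans (le_of_eq ?_) (abs_add_three _ _ _)
        congr 1
        ring
    _ = ∫ x, |g x - s x| ∂μ + ∫ x, |s x - ∫ y, s y ∂μ - (h x - h (T x))| ∂μ
          + |∫ y, s y ∂μ - ∫ y, g y ∂μ| := by
        rw [integral_add (f := fun x => |g x - s x| + |s x - ∫ y, s y ∂μ - (h x - h (T x))|)
          (i1.add i2) (integrable_const _), integral_add i1 i2]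
        simp
    _ < ε := by linarith

end Coboundary

/-! ### Taylor remainder and the deterministic telescoping estimate -/

section Exponential

open Complex

/-- The remainder of the second order Taylor expansion of `u ↦ exp (u * I)` at `0`. -/
noncomputable def cexpRemainder (u : ℝ) : ℂ := cexp (u * I) - 1 - u * I + u ^ 2 / 2

theorem continuous_cexpRemainder : Continuous cexpRemainder := by
  unfold cexpRemainder
  fun_prop

theorem norm_cexp_ofReal_mul_I_sub_one_le (u : ℝ) : ‖cexp (u * I) - 1‖ ≤ |u| := by
  simpa [mul_comm] using Real.norm_exp_I_mul_ofReal_sub_one_le (x := u)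

theorem norm_cexpRemainder_le_cube {u : ℝ} (hu : |u| ≤ 1) : ‖cexpRemainder u‖ ≤ |u| ^ 3 := by
  have h := Complex.exp_bound (x := u * I) (by simpa using hu) (n := 3) (by norm_num)
  have h1 : cexp (u * I) - ∑ m ∈ Finset.range 3, (u * I) ^ m / (m.factorial : ℂ) =
      cexpRemainder u := by
    simp only [cexpRemainder, Finset.sum_range_succ, Finset.sum_range_zero, mul_pow, I_sq]
    norm_num [Nat.factorial]
    ring
  rw [h1] at h
  refine h.trans ?_
  have h2 : ‖(u * I : ℂ)‖ = |u| := by simp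
  rw [h2]
  norm_num [Nat.factorial]
  nlinarith [pow_nonneg (abs_nonneg u) 3]

/-- This global bound provides the dominating function under a bare second moment; the cubic bound
near `0` provides pointwise convergence. -/
theorem norm_cexpRemainder_le_sq (u : ℝ) : ‖cexpRemainder u‖ ≤ 3 * u ^ 2 := by
  rcases le_or_gt |u| 1 with hu | hu
  · refine (norm_cexpRemainder_le_cube hu).trans ?_
    rw [← sq_abs u]
    nlinarith [pow_nonneg (abs_nonneg u) 2, abs_nonneg u]
  · have h1 : ‖cexpRemainder u‖ ≤ ‖cexp (u * I) - 1‖ + ‖(u * I : ℂ)‖ + ‖((u : ℂ) ^ 2 / 2)‖ :=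
      (norm_add_le _ _).trans (by gcongr; exact norm_sub_le _ _)
    have h2 : ‖(u * I : ℂ)‖ = |u| := by simp
    have h3 : ‖((u : ℂ) ^ 2 / 2)‖ = |u| ^ 2 / 2 := by simp
    have h4 := norm_cexp_ofReal_mul_I_sub_one_le u
    rw [h2, h3] at h1
    rw [← sq_abs u]
    nlinarith

/-- Summation by parts. -/
theorem norm_sum_mul_sub_succ_le (a : ℕ → ℂ) (h : ℕ → ℝ) (n : ℕ) :
    ‖∑ k ∈ Finset.range n, a k * (h k - h (k + 1) : ℝ)‖ ≤
      ‖a 0‖ * |h 0| + ‖a n‖ * |h n| +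
        ∑ k ∈ Finset.range n, ‖a (k + 1) - a k‖ * |h (k + 1)| := by
  have key : ∑ k ∈ Finset.range n, a k * (h k - h (k + 1) : ℝ) =
      a 0 * h 0 - a n * h n + ∑ k ∈ Finset.range n, (a (k + 1) - a k) * h (k + 1) := by
    induction n with
    | zero => simp
    | succ n ih =>
      rw [Finset.sum_range_succ, ih, Finset.sum_range_succ]
      push_cast
      ring
  rw [key]
  refine (norm_add_le _ _).trans (add_le_add ((norm_sub_le _ _).trans ?_)
    ((norm_sum_le _ _).trans ?_))
  · simp
  · simp

theorem sub_pow_eq_sum (E : ℕ → ℂ) (hE : E 0 = 1) (q : ℂ) (n : ℕ) :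
    E n - q ^ n = ∑ k ∈ Finset.range n, q ^ (n - 1 - k) * (E (k + 1) - q * E k) := by
  have h := Finset.sum_range_sub (fun k => q ^ (n - k) * E k) n
  simp only [Nat.sub_self, pow_zero, one_mul, Nat.sub_zero, hE, mul_one] at h
  rw [← h]
  refine Finset.sum_congr rfl fun k hk => ?_
  have hk' := Finset.mem_range.1 hk
  have h1 : n - (k + 1) = n - 1 - k := by omega
  have h2 : n - k = n - 1 - k + 1 := by omega
  rw [h1, h2, pow_succ]
  ring

/-- Up to a term that is linear in the increments `y k`, the exponential of the partial sums of `y`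
is close to the corresponding Gaussian factor, provided that `y k ^ 2 - v` is close to the
coboundary `h k - h (k + 1)`. -/
theorem norm_cexp_sum_sub_pow_sub_le (y h : ℕ → ℝ) (l : ℝ) {v : ℝ} (hv : 0 ≤ v) (n : ℕ) :
    ‖cexp ((l * ∑ j ∈ Finset.range n, y j : ℝ) * I) - (Real.exp (-(l ^ 2 * v / 2)) : ℂ) ^ n -
        ∑ k ∈ Finset.range n, (Real.exp (-(l ^ 2 * v / 2)) : ℂ) ^ (n - 1 - k) * (l * I) *
          (cexp ((l * ∑ j ∈ Finset.range k, y j : ℝ) * I) * y k)‖ ≤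
      ∑ k ∈ Finset.range n, (‖cexpRemainder (l * y k)‖ +
          |Real.exp (-(l ^ 2 * v / 2)) - 1 - -(l ^ 2 * v / 2)| +
          l ^ 2 / 2 * (|y k ^ 2 - v - (h k - h (k + 1))| +
            (|l| * |y k| + l ^ 2 * v / 2) * |h (k + 1)|)) +
        l ^ 2 / 2 * (|h 0| + |h n|) := by
  set q : ℝ := Real.exp (-(l ^ 2 * v / 2)) with hq
  set s : ℝ := l ^ 2 * v / 2 with hs
  have hs0 : 0 ≤ s := by positivity
  have hq0 : 0 ≤ q := (Real.exp_pos _).le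
  have hq1 : q ≤ 1 := Real.exp_le_one_iff.2 (by linarith)
  have hqs : 1 - q ≤ s := by have := Real.add_one_le_exp (-s); rw [← hq] at this; linarith
  set E : ℕ → ℂ := fun k => cexp ((l * ∑ j ∈ Finset.range k, y j : ℝ) * I) with hE
  have hEn : ∀ k, ‖E k‖ = 1 := fun k => norm_exp_ofReal_mul_I _
  have hE0 : E 0 = 1 := by simp [hE]
  have hEs : ∀ k, E (k + 1) = E k * cexp ((l * y k : ℝ) * I) := by
    intro k
    simp only [hE]
    rw [← Complex.exp_add, Finset.sum_range_succ]
    congr 1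
    push_cast
    ring
  set a : ℕ → ℂ := fun k => (q : ℂ) ^ (n - 1 - k) * E k with ha
  have hqn : ∀ m : ℕ, ‖(q : ℂ) ^ m‖ ≤ 1 := fun m => by
    rw [norm_pow, norm_real, Real.norm_of_nonneg hq0]
    exact pow_le_one₀ hq0 hq1
  have han : ∀ k, ‖a k‖ ≤ 1 := fun k => by
    simp only [ha, norm_mul, hEn, mul_one]
    exact hqn _
  have had : ∀ k ∈ Finset.range n, ‖a (k + 1) - a k‖ ≤ |l| * |y k| + s := by
    intro k hk
    have hk' := Finset.mem_range.1 hk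
    have hone : ‖cexp ((l * y k : ℝ) * I) - 1‖ ≤ |l| * |y k| := by
      simpa [abs_mul] using norm_cexp_ofReal_mul_I_sub_one_le (l * y k)
    -- For `k + 1 = n` the truncated exponent `n - 1 - (k + 1)` is `0`, so the power of `q` does not
    -- change and only `E` varies.
    rcases (show k + 1 = n ∨ k + 1 < n by omega) with hkn | hkn
    · have e1 : n - 1 - (k + 1) = 0 := by omega
      have e2 : n - 1 - k = 0 := by omega
      have : a (k + 1) - a k = E k * (cexp ((l * y k : ℝ) * I) - 1) := by
        simp only [ha, e1, e2, hEs]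
        ring
      rw [this, norm_mul, hEn, one_mul]
      linarith
    · have e2 : n - 1 - k = n - 1 - (k + 1) + 1 := by omega
      have : a (k + 1) - a k = (q : ℂ) ^ (n - 1 - (k + 1)) *
          (E k * ((cexp ((l * y k : ℝ) * I) - 1) + (1 - q : ℝ))) := by
        simp only [ha, e2, hEs, pow_succ]
        push_cast
        ring
      rw [this, norm_mul, norm_mul, hEn, one_mul]
      calc _ ≤ 1 * (|l| * |y k| + s) := by
            gcongr
            · exact hqn _
            · refine (norm_add_le _ _).trans (add_le_add hone ?_)
              rw [norm_real, Real.norm_of_nonneg (by linarith)]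
              exact hqs
        _ = _ := one_mul _
  -- Telescope, then expand both `cexp (l * y k * I)` and `q`: the constants cancel and the linear
  -- term is the one subtracted.
  have key : E n - (q : ℂ) ^ n -
      ∑ k ∈ Finset.range n, (q : ℂ) ^ (n - 1 - k) * (l * I) * (E k * y k) =
      ∑ k ∈ Finset.range n, (a k * (cexpRemainder (l * y k) - (q - 1 - -s : ℝ)) -
        (l ^ 2 / 2 : ℝ) * (a k * (y k ^ 2 - v - (h k - h (k + 1)) : ℝ))) -
      (l ^ 2 / 2 : ℝ) * ∑ k ∈ Finset.range n, a k * (h k - h (k + 1) : ℝ) := by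
    rw [sub_pow_eq_sum E hE0, Finset.mul_sum, ← Finset.sum_sub_distrib, ← Finset.sum_sub_distrib]
    refine Finset.sum_congr rfl fun k _ => ?_
    simp only [ha, hEs, cexpRemainder, hs]
    push_cast
    ring
  change ‖E n - (q : ℂ) ^ n -
      ∑ k ∈ Finset.range n, (q : ℂ) ^ (n - 1 - k) * (l * I) * (E k * y k)‖ ≤ _
  rw [key]
  have hl : ‖((l ^ 2 / 2 : ℝ) : ℂ)‖ = l ^ 2 / 2 := by
    rw [norm_real, Real.norm_of_nonneg (by positivity)]
  have h1 : ‖∑ k ∈ Finset.range n, (a k * (cexpRemainder (l * y k) - (q - 1 - -s : ℝ)) -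
        (l ^ 2 / 2 : ℝ) * (a k * (y k ^ 2 - v - (h k - h (k + 1)) : ℝ)))‖ ≤
      ∑ k ∈ Finset.range n, (‖cexpRemainder (l * y k)‖ + |q - 1 - -s| +
        l ^ 2 / 2 * |y k ^ 2 - v - (h k - h (k + 1))|) := by
    refine (norm_sum_le _ _).trans (Finset.sum_le_sum fun k _ => ?_)
    refine (norm_sub_le _ _).trans (add_le_add ?_ ?_)
    · rw [norm_mul]
      refine (mul_le_of_le_one_left (norm_nonneg _) (han k)).trans ((norm_sub_le _ _).trans ?_)
      rw [norm_real, Real.norm_eq_abs]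
    · rw [norm_mul, norm_mul, hl]
      gcongr
      refine (mul_le_of_le_one_left (norm_nonneg _) (han k)).trans ?_
      rw [norm_real, Real.norm_eq_abs]
  have h2 : ‖∑ k ∈ Finset.range n, a k * (h k - h (k + 1) : ℝ)‖ ≤ |h 0| + |h n| +
      ∑ k ∈ Finset.range n, (|l| * |y k| + s) * |h (k + 1)| := by
    refine (norm_sum_mul_sub_succ_le a h n).trans (add_le_add (add_le_add ?_ ?_) ?_)
    · exact mul_le_of_le_one_left (abs_nonneg _) (han 0)
    · exact mul_le_of_le_one_left (abs_nonneg _) (han n)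
    · exact Finset.sum_le_sum fun k hk => mul_le_mul_of_nonneg_right (had k hk) (abs_nonneg _)
  have h3 : ‖((l ^ 2 / 2 : ℝ) : ℂ) * ∑ k ∈ Finset.range n, a k * (h k - h (k + 1) : ℝ)‖ ≤
      l ^ 2 / 2 * (|h 0| + |h n| +
      ∑ k ∈ Finset.range n, (|l| * |y k| + s) * |h (k + 1)|) := by
    rw [norm_mul, hl]
    gcongr
  refine (norm_sub_le _ _).trans ((add_le_add h1 h3).trans (le_of_eq ?_))
  simp only [mul_add, Finset.sum_add_distrib, Finset.mul_sum]
  ring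

end Exponential

/-! ### Characteristic functions of Birkhoff sums over an ergodic system -/

section ErgodicCLT

open Complex Topology

variable {X : Type*} [MeasurableSpace X] {μ : Measure X} {T : X → X} {f : X → ℝ}

theorem measurable_birkhoffSum (hT : Measurable T) (hf : Measurable f) (n : ℕ) :
    Measurable (birkhoffSum T f n) := by
  unfold birkhoffSum
  exact Finset.measurable_fun_sum _ fun k _ => hf.comp (hT.iterate k)

theorem MeasureTheory.MeasurePreserving.integral_comp_iterate (hT : MeasurePreserving T μ μ)
    {g : X → ℝ} (hg : AEStronglyMeasurable g μ) (k : ℕ) :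
    ∫ x, g (T^[k] x) ∂μ = ∫ x, g x ∂μ := by
  have h := hT.iterate k
  rw [← integral_map h.aemeasurable (by rwa [h.map_eq]), h.map_eq]

theorem MeasureTheory.MeasurePreserving.integrable_birkhoffSum (hT : MeasurePreserving T μ μ)
    {g : X → ℝ} (hg : Integrable g μ) (n : ℕ) : Integrable (birkhoffSum T g n) μ :=
  integrable_finsetSum _ fun k _ => (hT.iterate k).integrable_comp_of_integrable hg

theorem MeasureTheory.MeasurePreserving.integral_birkhoffSum (hT : MeasurePreserving T μ μ)
    {g : X → ℝ} (hg : Integrable g μ) (n : ℕ) :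
    ∫ x, birkhoffSum T g n x ∂μ = n * ∫ x, g x ∂μ := by
  have hi : ∀ k, Integrable (fun x => g (T^[k] x)) μ :=
    fun k => (hT.iterate k).integrable_comp_of_integrable hg
  unfold birkhoffSum
  rw [integral_finsetSum _ fun k _ => hi k]
  simp [hT.integral_comp_iterate hg.1]

theorem integrable_cexp_ofReal_mul_I [IsFiniteMeasure μ] {g : X → ℝ} (hg : Measurable g) :
    Integrable (fun x => cexp (g x * I)) μ :=
  Integrable.of_bound (by fun_prop) 1 (ae_of_all _ fun x => (norm_exp_ofReal_mul_I _).le)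

/-- Integrate the deterministic estimate along orbits: `horth` removes the linear sum, and
invariance of `μ` makes all `n` summands of the bound have equal integral. -/
theorem norm_integral_cexp_birkhoffSum_sub_pow_le [IsProbabilityMeasure μ]
    (hT : MeasurePreserving T μ μ) (hfm : Measurable f) (hf : MemLp f 2 μ)
    (horth : ∀ (k : ℕ) (l : ℝ),
      ∫ x, cexp ((l * birkhoffSum T f k x : ℝ) * I) * f (T^[k] x) ∂μ = 0)
    {h : X → ℝ} (hh : MemLp h 2 μ) {v : ℝ} (hv : 0 ≤ v) (l : ℝ) (n : ℕ) :
    ‖∫ x, cexp ((l * birkhoffSum T f n x : ℝ) * I) ∂μ -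
        (Real.exp (-(l ^ 2 * v / 2)) : ℂ) ^ n‖ ≤
      n * (∫ x, ‖cexpRemainder (l * f x)‖ ∂μ +
        |Real.exp (-(l ^ 2 * v / 2)) - 1 - -(l ^ 2 * v / 2)| +
        l ^ 2 / 2 * (∫ x, |f x ^ 2 - v - (h x - h (T x))| ∂μ +
          (|l| * ∫ x, |f x| * |h (T x)| ∂μ + l ^ 2 * v / 2 * ∫ x, |h (T x)| ∂μ))) +
      l ^ 2 / 2 * (∫ x, |h x| ∂μ + ∫ x, |h x| ∂μ) := by
  set q : ℝ := Real.exp (-(l ^ 2 * v / 2)) with hq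
  have hTm : Measurable T := hT.measurable
  have hhT : MemLp (fun x => h (T x)) 2 μ := hh.comp_measurePreserving hT
  have ihT : Integrable (fun x => |h (T x)|) μ := (hhT.integrable (by norm_num)).abs
  have ih : Integrable (fun x => |h x|) μ := (hh.integrable (by norm_num)).abs
  have ihn : Integrable (fun x => |h (T^[n] x)|) μ :=
    (hT.iterate n).integrable_comp_of_integrable ih
  have ifh : Integrable (fun x => |f x| * |h (T x)|) μ := by
    simpa [abs_mul] using (hf.integrable_mul hhT).abs
  have iw : Integrable (fun x => |f x ^ 2 - v - (h x - h (T x))|) μ :=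
    ((hf.integrable_sq.sub (integrable_const v)).sub
      ((hh.integrable (by norm_num)).sub (hhT.integrable (by norm_num)))).abs
  have iR : Integrable (fun x => ‖cexpRemainder (l * f x)‖) μ := by
    refine Integrable.mono' (g := fun x => 3 * l ^ 2 * f x ^ 2) (hf.integrable_sq.const_mul _)
      ((continuous_cexpRemainder.measurable.comp
        (hfm.const_mul l)).norm.aestronglyMeasurable) (ae_of_all _ fun x => ?_)
    rw [norm_norm]
    exact (norm_cexpRemainder_le_sq _).trans (le_of_eq (by ring))
  set φ : X → ℝ := fun x => ‖cexpRemainder (l * f x)‖ + |q - 1 - -(l ^ 2 * v / 2)| +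
    l ^ 2 / 2 * (|f x ^ 2 - v - (h x - h (T x))| +
      (|l| * |f x| + l ^ 2 * v / 2) * |h (T x)|) with hφ
  have hφ' : φ = fun x => (‖cexpRemainder (l * f x)‖ + |q - 1 - -(l ^ 2 * v / 2)|) +
    l ^ 2 / 2 * (|f x ^ 2 - v - (h x - h (T x))| +
      (|l| * (|f x| * |h (T x)|) + l ^ 2 * v / 2 * |h (T x)|)) := by
    funext x
    simp only [hφ]
    ring
  have i1 := (ifh.const_mul |l|).add (ihT.const_mul (l ^ 2 * v / 2))
  have i2 := (iw.add i1).const_mul (l ^ 2 / 2)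
  have i3 := iR.add (integrable_const (μ := μ) |q - 1 - -(l ^ 2 * v / 2)|)
  have iφ : Integrable φ μ := by rw [hφ']; exact i3.add i2
  have hφint : ∫ x, φ x ∂μ = ∫ x, ‖cexpRemainder (l * f x)‖ ∂μ +
        |q - 1 - -(l ^ 2 * v / 2)| +
        l ^ 2 / 2 * (∫ x, |f x ^ 2 - v - (h x - h (T x))| ∂μ +
          (|l| * ∫ x, |f x| * |h (T x)| ∂μ + l ^ 2 * v / 2 * ∫ x, |h (T x)| ∂μ)) := by
    rw [hφ']
    refine (integral_add i3 i2).trans ?_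
    congr 1
    · refine (integral_add iR (integrable_const _)).trans ?_
      simp
    · rw [integral_const_mul]
      congr 1
      refine (integral_add iw i1).trans ?_
      congr 1
      refine (integral_add (ifh.const_mul _) (ihT.const_mul _)).trans ?_
      rw [integral_const_mul, integral_const_mul]
  set L : X → ℂ := fun x => ∑ k ∈ Finset.range n, (q : ℂ) ^ (n - 1 - k) * (l * I) *
    (cexp ((l * birkhoffSum T f k x : ℝ) * I) * f (T^[k] x)) with hL
  have iterm : ∀ k, Integrable
      (fun x => cexp ((l * birkhoffSum T f k x : ℝ) * I) * (f (T^[k] x) : ℂ)) μ := by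
    intro k
    have hfk : Integrable (fun x => (f (T^[k] x) : ℂ)) μ :=
      ((hT.iterate k).integrable_comp_of_integrable (hf.integrable (by norm_num))).ofReal
    refine hfk.bdd_mul (c := 1)
      (integrable_cexp_ofReal_mul_I ((measurable_birkhoffSum hTm hfm k).const_mul l)).1
      (ae_of_all _ fun x => (norm_exp_ofReal_mul_I _).le)
  have hL0 : ∫ x, L x ∂μ = 0 := by
    rw [hL, integral_finsetSum _ fun k _ => (iterm k).const_mul _]
    refine Finset.sum_eq_zero fun k _ => ?_
    rw [integral_const_mul, horth, mul_zero]
  have iL : Integrable L μ := integrable_finsetSum _ fun k _ => (iterm k).const_mul _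
  have iE : Integrable (fun x => cexp ((l * birkhoffSum T f n x : ℝ) * I)) μ :=
    integrable_cexp_ofReal_mul_I ((measurable_birkhoffSum hTm hfm n).const_mul l)
  have hrw : ∫ x, cexp ((l * birkhoffSum T f n x : ℝ) * I) ∂μ - (q : ℂ) ^ n =
      ∫ x, (cexp ((l * birkhoffSum T f n x : ℝ) * I) - (q : ℂ) ^ n - L x) ∂μ := by
    refine Eq.symm ((integral_sub (iE.sub (integrable_const _)) iL).trans ?_)
    rw [hL0, sub_zero]
    exact (integral_sub iE (integrable_const _)).trans (by simp)
  rw [hrw]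
  have iB : Integrable (fun x => l ^ 2 / 2 * (|h x| + |h (T^[n] x)|)) μ :=
    (ih.add ihn).const_mul _
  have iG := hT.integrable_birkhoffSum iφ n
  refine (norm_integral_le_of_norm_le (iG.add iB) (ae_of_all _ fun x => ?_)).trans (le_of_eq ?_)
  · have := norm_cexp_sum_sub_pow_sub_le (fun k => f (T^[k] x)) (fun k => h (T^[k] x)) l hv n
    simp only [Function.iterate_succ_apply', Function.iterate_zero, id] at this
    exact this
  · refine (integral_add iG iB).trans ?_
    rw [hT.integral_birkhoffSum iφ, hφint, integral_const_mul, integral_add ih ihn,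
      hT.integral_comp_iterate ih.1]

theorem tendsto_inv_sqrt_mul_const (t : ℝ) :
    Tendsto (fun n : ℕ => (√(n : ℝ))⁻¹ * t) atTop (𝓝 0) := by
  rw [← zero_mul t]
  exact .mul_const t (tendsto_inv_atTop_zero.comp <| Real.tendsto_sqrt_atTop.comp <|
    tendsto_natCast_atTop_atTop)

theorem natCast_mul_inv_sqrt_mul_sq {n : ℕ} (hn : n ≠ 0) (t : ℝ) :
    n * ((√(n : ℝ))⁻¹ * t) ^ 2 = t ^ 2 := by
  have : (n : ℝ) ≠ 0 := by exact_mod_cast hn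
  rw [mul_pow, inv_pow, Real.sq_sqrt (Nat.cast_nonneg n)]
  field_simp

theorem natCast_mul_inv_sqrt_mul_sq_le (n : ℕ) (t : ℝ) :
    n * ((√(n : ℝ))⁻¹ * t) ^ 2 ≤ t ^ 2 := by
  rcases eq_or_ne n 0 with rfl | hn
  · simpa using sq_nonneg t
  · exact (natCast_mul_inv_sqrt_mul_sq hn t).le

/-- Dominated convergence takes the place of a Lindeberg condition. -/
theorem tendsto_natCast_mul_integral_norm_cexpRemainder (hfm : Measurable f)
    (hf : MemLp f 2 μ) (t : ℝ) :
    Tendsto (fun n : ℕ => (n : ℝ) * ∫ x, ‖cexpRemainder ((√(n : ℝ))⁻¹ * t * f x)‖ ∂μ) atTop (𝓝 0) := by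
  have key : Tendsto (fun n : ℕ => ∫ x, n * ‖cexpRemainder ((√(n : ℝ))⁻¹ * t * f x)‖ ∂μ) atTop
      (𝓝 (∫ _, (0 : ℝ) ∂μ)) := by
    refine tendsto_integral_of_dominated_convergence (fun x => 3 * t ^ 2 * f x ^ 2)
      (fun n => ?_) (hf.integrable_sq.const_mul _) (fun n => ae_of_all _ fun x => ?_)
      (ae_of_all _ fun x => ?_)
    · exact ((continuous_cexpRemainder.measurable.comp
        (hfm.const_mul _)).norm.const_mul _).aestronglyMeasurable
    · rw [Real.norm_of_nonneg (by positivity)]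
      have h1 := natCast_mul_inv_sqrt_mul_sq_le n t
      calc n * ‖cexpRemainder ((√(n : ℝ))⁻¹ * t * f x)‖
          ≤ n * (3 * ((√(n : ℝ))⁻¹ * t * f x) ^ 2) := by
            gcongr
            exact norm_cexpRemainder_le_sq _
        _ = 3 * (n * ((√(n : ℝ))⁻¹ * t) ^ 2) * f x ^ 2 := by ring
        _ ≤ _ := by gcongr
    · have hu : Tendsto (fun n : ℕ => |(√(n : ℝ))⁻¹ * t * f x|) atTop (𝓝 0) := by
        simpa using ((tendsto_inv_sqrt_mul_const t).mul_const (f x)).abs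
      have hu' : Tendsto (fun n : ℕ => t ^ 2 * f x ^ 2 * |(√(n : ℝ))⁻¹ * t * f x|) atTop
          (𝓝 0) := by simpa using hu.const_mul (t ^ 2 * f x ^ 2)
      refine squeeze_zero' (Eventually.of_forall fun n => by positivity) ?_ hu'
      filter_upwards [hu.eventually_le_const zero_lt_one] with n hn
      calc n * ‖cexpRemainder ((√(n : ℝ))⁻¹ * t * f x)‖
          ≤ n * |(√(n : ℝ))⁻¹ * t * f x| ^ 3 := by
            gcongr
            exact norm_cexpRemainder_le_cube hn
        _ = n * ((√(n : ℝ))⁻¹ * t) ^ 2 * f x ^ 2 * |(√(n : ℝ))⁻¹ * t * f x| := by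
            rw [pow_succ, sq_abs]
            ring
        _ ≤ _ := by
            gcongr
            exact natCast_mul_inv_sqrt_mul_sq_le n t
  simpa [integral_const_mul] using key

theorem tendsto_natCast_mul_abs_exp_sub (t v : ℝ) :
    Tendsto (fun n : ℕ => (n : ℝ) * |Real.exp (-(((√(n : ℝ))⁻¹ * t) ^ 2 * v / 2)) - 1 -
      -(((√(n : ℝ))⁻¹ * t) ^ 2 * v / 2)|) atTop (𝓝 0) := by
  have hl : Tendsto (fun n : ℕ => ((√(n : ℝ))⁻¹ * t) ^ 2) atTop (𝓝 0) := by
    simpa using (tendsto_inv_sqrt_mul_const t).pow 2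
  have hs : Tendsto (fun n : ℕ => |-(((√(n : ℝ))⁻¹ * t) ^ 2 * v / 2)|) atTop (𝓝 0) := by
    simpa using (((hl.mul_const v).div_const 2).neg).abs
  have hb : Tendsto (fun n : ℕ => t ^ 2 * v ^ 2 / 4 * ((√(n : ℝ))⁻¹ * t) ^ 2) atTop (𝓝 0) := by
    simpa using hl.const_mul (t ^ 2 * v ^ 2 / 4)
  refine squeeze_zero' (Eventually.of_forall fun n => by positivity) ?_ hb
  filter_upwards [hs.eventually_le_const zero_lt_one] with n hn
  calc _ ≤ (n : ℝ) * (-(((√(n : ℝ))⁻¹ * t) ^ 2 * v / 2)) ^ 2 := by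
        gcongr
        exact Real.abs_exp_sub_one_sub_id_le hn
    _ = (n * ((√(n : ℝ))⁻¹ * t) ^ 2) * (v ^ 2 / 4 * ((√(n : ℝ))⁻¹ * t) ^ 2) := by ring
    _ ≤ t ^ 2 * (v ^ 2 / 4 * ((√(n : ℝ))⁻¹ * t) ^ 2) := by
        gcongr
        exact natCast_mul_inv_sqrt_mul_sq_le n t
    _ = _ := by ring

theorem Ergodic.tendsto_integral_cexp_birkhoffSum [IsProbabilityMeasure μ]
    (hT : Ergodic T μ) (hfm : Measurable f) (hf : MemLp f 2 μ)
    (horth : ∀ (k : ℕ) (l : ℝ),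
      ∫ x, cexp ((l * birkhoffSum T f k x : ℝ) * I) * f (T^[k] x) ∂μ = 0) (t : ℝ) :
    Tendsto (fun n : ℕ => ∫ x, cexp (((√(n : ℝ))⁻¹ * t * birkhoffSum T f n x : ℝ) * I) ∂μ) atTop
      (𝓝 (Real.exp (-(t ^ 2 * (∫ x, f x ^ 2 ∂μ) / 2)) : ℂ)) := by
  set v := ∫ x, f x ^ 2 ∂μ with hv
  have hv0 : 0 ≤ v := integral_nonneg fun x => sq_nonneg _
  rw [Metric.tendsto_atTop']
  intro ε hε
  -- `h` is fixed before `n` grows; the surviving error is `t²δ/2`, and the `+ 1` covers `t = 0`.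
  obtain ⟨h, hh, hδ⟩ := hT.exists_integral_abs_sub_coboundary_lt hf.integrable_sq
    (ε := ε / (t ^ 2 + 1)) (by positivity)
  rw [← hv] at hδ
  set δ := ∫ x, |f x ^ 2 - v - (h x - h (T x))| ∂μ
  set K := ∫ x, |f x| * |h (T x)| ∂μ
  set H' := ∫ x, |h (T x)| ∂μ
  set H := ∫ x, |h x| ∂μ
  have hδ0 : 0 ≤ δ := integral_nonneg fun x => abs_nonneg _
  have hl := tendsto_inv_sqrt_mul_const t
  have hl2 : Tendsto (fun n : ℕ => ((√(n : ℝ))⁻¹ * t) ^ 2) atTop (𝓝 0) := by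
    simpa using hl.pow 2
  have hla : Tendsto (fun n : ℕ => |(√(n : ℝ))⁻¹ * t|) atTop (𝓝 0) := by simpa using hl.abs
  have hB : Tendsto (fun n : ℕ =>
      ((n : ℝ) * ∫ x, ‖cexpRemainder ((√(n : ℝ))⁻¹ * t * f x)‖ ∂μ +
        (n : ℝ) * |Real.exp (-(((√(n : ℝ))⁻¹ * t) ^ 2 * v / 2)) - 1 -
          -(((√(n : ℝ))⁻¹ * t) ^ 2 * v / 2)| +
        t ^ 2 / 2 * (δ + (|(√(n : ℝ))⁻¹ * t| * K + ((√(n : ℝ))⁻¹ * t) ^ 2 * v / 2 * H'))) +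
      ((√(n : ℝ))⁻¹ * t) ^ 2 / 2 * (H + H)) atTop
      (𝓝 ((0 + 0 + t ^ 2 / 2 * (δ + (0 * K + 0 * v / 2 * H'))) + 0 / 2 * (H + H))) :=
    (((tendsto_natCast_mul_integral_norm_cexpRemainder hfm hf t).add
      (tendsto_natCast_mul_abs_exp_sub t v)).add
      (((hla.mul_const K).add (((hl2.mul_const v).div_const 2).mul_const H')).const_add δ
        |>.const_mul (t ^ 2 / 2))).add ((hl2.div_const 2).mul_const (H + H))
  have hlim : (0 + 0 + t ^ 2 / 2 * (δ + (0 * K + 0 * v / 2 * H'))) + 0 / 2 * (H + H) < ε := by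
    have h1 : δ * (t ^ 2 + 1) < ε := (lt_div_iff₀ (by positivity)).1 hδ
    nlinarith [mul_nonneg hδ0 (sq_nonneg t)]
  have hev := (hB.eventually_lt_const hlim).and (eventually_ge_atTop 1)
  obtain ⟨N, hN⟩ := eventually_atTop.1 hev
  refine ⟨N, fun n hn => ?_⟩
  obtain ⟨hlt, hn1⟩ := hN n hn.le
  have hn0 : n ≠ 0 := by omega
  have hsq := natCast_mul_inv_sqrt_mul_sq hn0 t
  have hpow : (Real.exp (-(t ^ 2 * v / 2)) : ℂ) =
      (Real.exp (-(((√(n : ℝ))⁻¹ * t) ^ 2 * v / 2)) : ℂ) ^ n := by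
    rw [← ofReal_pow, ← Real.exp_nat_mul, ← hsq]
    congr 2
    ring
  rw [dist_eq_norm, hpow]
  refine (norm_integral_cexp_birkhoffSum_sub_pow_le hT.toMeasurePreserving hfm hf horth hh hv0
    _ n).trans_lt (lt_of_eq_of_lt ?_ hlt)
  rw [← hsq]
  ring

end ErgodicCLT

/-! ### The shift on the path space -/

section SequenceSpace

variable {Ω : Type*} {mΩ : MeasurableSpace Ω} {P : Measure Ω} {Y : ℕ → Ω → ℝ}

theorem measurable_seqShift : Measurable seqShift :=
  measurable_pi_lambda _ fun n => measurable_pi_apply (n + 1)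

theorem iterate_seqShift_apply (k : ℕ) (x : ℕ → ℝ) (n : ℕ) : seqShift^[k] x n = x (k + n) := by
  induction k generalizing n with
  | zero => simp
  | succ k ih =>
    rw [Function.iterate_succ_apply', seqShift, ih]
    congr 1
    omega

theorem birkhoffSum_seqShift_apply_zero (n : ℕ) (x : ℕ → ℝ) :
    birkhoffSum seqShift (fun y => y 0) n x = ∑ j ∈ Finset.range n, x j := by
  simp [birkhoffSum, iterate_seqShift_apply]

theorem IsStationarySeq.measurePreserving_seqShift (hY : ∀ n, Measurable (Y n))
    (hstat : IsStationarySeq Y P) :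
    MeasurePreserving seqShift (pathLaw Y P) (pathLaw Y P) := by
  refine ⟨measurable_seqShift, ?_⟩
  rw [pathLaw, Measure.map_map measurable_seqShift (measurable_pi_lambda _ hY)]
  have h := (hstat 1).map_eq
  rw [← h]
  congr 1
  funext ω n
  simp [seqShift, add_comm]

theorem IsStationarySeq.identDistrib_zero (hstat : IsStationarySeq Y P) (i : ℕ) :
    IdentDistrib (Y i) (Y 0) P P :=
  (hstat i).comp (u := fun x : ℕ → ℝ => x 0) (measurable_pi_apply 0)

end SequenceSpace

/-! ### Orthogonality from the martingale property -/

section MartingaleDifference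

open Complex

variable {Ω : Type*} {mΩ : MeasurableSpace Ω} {P : Measure Ω} {Y : ℕ → Ω → ℝ}
  {ℱ : Filtration ℕ mΩ}

theorem IsMartingaleDifference.measurable (hmart : IsMartingaleDifference Y ℱ P) (n : ℕ) :
    Measurable (Y n) :=
  ((hmart.adapted n).mono (ℱ.le n)).measurable

/-- The conditional expectations constrain only `Y 1, Y 2, …`; stationarity carries the zero mean
back to `Y 0`. -/
theorem IsMartingaleDifference.integral_zero_eq_zero [IsProbabilityMeasure P]
    (hmart : IsMartingaleDifference Y ℱ P) (hstat : IsStationarySeq Y P) :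
    ∫ ω, Y 0 ω ∂P = 0 := by
  rw [← (hstat.identDistrib_zero 1).integral_eq, ← integral_condExp (ℱ.le 0),
    integral_congr_ae (hmart.condExp_eq_zero 0)]
  simp

theorem IsMartingaleDifference.integral_cexp_mul_eq_zero [IsProbabilityMeasure P]
    (hmart : IsMartingaleDifference Y ℱ P) (hstat : IsStationarySeq Y P) (k : ℕ) (l : ℝ) :
    ∫ ω, cexp ((l * ∑ j ∈ Finset.range k, Y j ω : ℝ) * I) * Y k ω ∂P = 0 := by
  cases k with
  | zero =>
    have h : ∫ ω, (Y 0 ω : ℂ) ∂P = (∫ ω, Y 0 ω ∂P : ℝ) := integral_complex_ofReal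
    simpa [hmart.integral_zero_eq_zero hstat] using h
  | succ k =>
    have hS : StronglyMeasurable[ℱ k] (fun ω => l * ∑ j ∈ Finset.range (k + 1), Y j ω) := by
      refine StronglyMeasurable.const_mul ?_ l
      refine Finset.stronglyMeasurable_fun_sum _ fun j hj => ?_
      exact (hmart.adapted j).mono (ℱ.mono (by have := Finset.mem_range.1 hj; omega))
    have hE : StronglyMeasurable[ℱ k]
        (fun ω => cexp ((l * ∑ j ∈ Finset.range (k + 1), Y j ω : ℝ) * I)) :=
      (by fun_prop : Continuous fun u : ℝ => cexp (u * I)).comp_stronglyMeasurable hS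
    -- Pull the bounded `ℱ k`-measurable exponential out of the conditional expectation; the
    -- bilinear map pairs a complex factor with a real one.
    have h := condExp_stronglyMeasurable_bilin_of_bound
      (ContinuousLinearMap.lsmul ℝ ℝ : ℝ →L[ℝ] ℂ →L[ℝ] ℂ).flip (ℱ.le k) hE
      (hmart.integrable (k + 1)) 1 (ae_of_all _ fun ω => (norm_exp_ofReal_mul_I _).le)
    have h2 := (integral_condExp (ℱ.le k)).symm.trans <| (integral_congr_ae h).trans <|
      integral_eq_zero_of_ae <| by
        filter_upwards [hmart.condExp_eq_zero k] with ω hω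
        rw [hω, Pi.zero_apply, Pi.zero_apply, map_zero]
    rw [← h2]
    refine integral_congr_ae (ae_of_all _ fun ω => ?_)
    simp [mul_comm]

end MartingaleDifference

/-! ### Transfer to the path space and Lévy's continuity theorem -/

theorem mainTheorem1 {Ω : Type*} {mΩ : MeasurableSpace Ω} (P : Measure Ω)
    [IsProbabilityMeasure P] (Y : ℕ → Ω → ℝ) (ℱ : Filtration ℕ mΩ)
    (hstat : IsStationarySeq Y P) (herg : IsErgodicSeq Y P)
    (hmart : IsMartingaleDifference Y ℱ P) (hmom : ∀ i, MemLp (Y i) 2 P) :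
    ∀ i : ℕ, TendstoInDistribution
      (fun (n : ℕ) (ω : Ω) => (√(n : ℝ))⁻¹ * ∑ j ∈ Finset.range n, Y j ω) atTop
      (id : ℝ → ℝ) (fun _ => P) (gaussianReal 0 (Var[Y i; P]).toNNReal) := by
  intro i
  have hYm := hmart.measurable
  have hpath : Measurable (fun ω n => Y n ω) := measurable_pi_lambda _ hYm
  have hSm : ∀ n, Measurable (fun ω => ∑ j ∈ Finset.range n, Y j ω) := fun n =>
    Finset.measurable_fun_sum _ fun j _ => hYm j
  have hprob : IsProbabilityMeasure (pathLaw Y P) :=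
    Measure.isProbabilityMeasure_map hpath.aemeasurable
  have hT : Ergodic seqShift (pathLaw Y P) :=
    ⟨hstat.measurePreserving_seqShift hYm, herg⟩
  have hfm : Measurable (fun x : ℕ → ℝ => x 0) := measurable_pi_apply 0
  have hf : MemLp (fun x : ℕ → ℝ => x 0) 2 (pathLaw Y P) :=
    (memLp_map_measure_iff hfm.aestronglyMeasurable hpath.aemeasurable).2 (hmom 0)
  have hsum : ∀ k, Measurable fun x : ℕ → ℝ => ∑ j ∈ Finset.range k, x j := fun k =>
    Finset.measurable_fun_sum _ fun j _ => measurable_pi_apply j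
  have horth : ∀ (k : ℕ) (l : ℝ), ∫ x, Complex.exp
      ((l * birkhoffSum seqShift (fun y => y 0) k x : ℝ) * Complex.I) *
        ((seqShift^[k] x 0 : ℝ) : ℂ) ∂(pathLaw Y P) = 0 := by
    intro k l
    simp only [birkhoffSum_seqShift_apply_zero, iterate_seqShift_apply, add_zero]
    rw [pathLaw, integral_map hpath.aemeasurable]
    · exact hmart.integral_cexp_mul_eq_zero hstat k l
    · have h1 := hsum k
      have h2 : Measurable fun x : ℕ → ℝ => x k := measurable_pi_apply k
      exact Measurable.aestronglyMeasurable (by fun_prop)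
  have hvar : Var[Y i; P] = ∫ x, x 0 ^ 2 ∂(pathLaw Y P) := by
    rw [(hstat.identDistrib_zero i).variance_eq, pathLaw,
      integral_map hpath.aemeasurable (hfm.pow_const 2).aestronglyMeasurable,
      variance_of_integral_eq_zero (hYm 0).aemeasurable (hmart.integral_zero_eq_zero hstat)]
  refine ⟨fun n => ((hSm n).const_mul _).aemeasurable, aemeasurable_id, ?_⟩
  refine ProbabilityMeasure.tendsto_iff_tendsto_charFun.2 fun t => ?_
  have key := hT.tendsto_integral_cexp_birkhoffSum hfm hf horth t
  rw [← hvar] at key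
  have hlimit : charFun (Measure.map id (gaussianReal 0 (Var[Y i; P]).toNNReal)) t =
      (Real.exp (-(t ^ 2 * Var[Y i; P] / 2)) : ℂ) := by
    rw [Measure.map_id, charFun_gaussianReal, Complex.ofReal_exp]
    congr 1
    rw [Real.coe_toNNReal _ (variance_nonneg _ _)]
    push_cast
    ring
  have hterm : ∀ n : ℕ,
      charFun (P.map fun ω => (√(n : ℝ))⁻¹ * ∑ j ∈ Finset.range n, Y j ω) t =
      ∫ x, Complex.exp (((√(n : ℝ))⁻¹ * t * birkhoffSum seqShift (fun y => y 0) n x : ℝ) *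
        Complex.I) ∂(pathLaw Y P) := by
    intro n
    simp only [birkhoffSum_seqShift_apply_zero]
    have h1 := hsum n
    rw [charFun_apply_real, integral_map ((hSm n).const_mul _).aemeasurable (by fun_prop),
      pathLaw, integral_map hpath.aemeasurable
        (Measurable.aestronglyMeasurable (by fun_prop))]
    refine integral_congr_ae (ae_of_all _ fun ω => ?_)
    push_cast
    ring_nf
  simp only [ProbabilityMeasure.coe_mk, hterm, hlimit]
  exact key
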